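/- Let $\omega$ be a homogeneous Poisson point process of unit intensity on $\mathbb R^2$, realized as a random locally finite set of points. For $s>0$ let $C_\omega([0,s]:\mathbb R^2)$ be the set of piecewise linear (continuous) paths $\gamma:[0,s]\to\mathbb R^2$ that visit each point of $\omega$ at most once, and let $$A^s(\gamma)=\frac12\int_0^s|\dot\gamma(u)|^2\,du-\omega_{pp}(\gamma),$$ where $\omega_{pp}(\gamma)$ is the number of points of $\omega$ on $\gamma$. For $S\subset\mathbb R^2$ let $A^s(S)=\inf A^s(\gamma)$, the infimum over all $\gamma\in C_\omega([0,s]:\mathbb R^2)$ with $\gamma(0)=0$, $\gamma(s)\in S$; a path attaining it is called a minimizer. Partition the plane into the unit squares $B_{(i,j)}=[i-\frac12,i+\frac12)\times[j-\frac12,j+\frac12)$, $(i,j)\in\mathbb Z^2$. A path passes through a square if it visits a point of that square, and it touches the square if it visits a point of $\omega$ in that square. A lattice animal is a finite nearest-neighbour-connected subset of $\mathbb Z^2$ containing the origin. For $n\ge1$, $N_n$ is the maximum of $\sum_{z\in\mathcal A}\omega(B_z)$ over the lattice animals $\mathcal A$ with $n$ elements, where $\omega(B)$ is the number of points of $\omega$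 in $B$; $N_0=0$. There are real constants $(C_k)_{k\in\mathbb N}$ such that for every $k\in\mathbb N$ there is $t_0$ such that for all $c\in(0,1]$, all $t\ge t_0$ and every $S\subset\mathbb R^2$ that contains a point $y$ with $|y|=t$, $$\mathbb E|A^{ct}(S)|^k\le C_kc^{-k}t^k,$$ and, whenever $\mathcal M$ is a choice, for almost every realization, of a minimizer for $A^{ct}(S)$, $$\mathbb E N_{|\mathcal A|}^k\le C_kc^{-k/2}t^k,\qquad \mathbb E L^{2k}\le C_{2k}t^{2k},\qquad \mathbb E|\mathcal A|^{2k}\le C_{2k}t^{2k},$$ where $L$ is the length of $\mathcal M$ and $\mathcal A$ is the set of unit squares touched by $\mathcal M$. The bounds on $N_{|\mathcal A|}$ and $|\mathcal A|$ hold also when $\mathcal A$ is the (possibly larger) set of unit squares that $\mathcal M$ passes through. Here $\mathbb E$ of a nonnegative function $f$ is the infimum of $\mathbb E g$ over measurable $g\ge f$ a.s., which is the usual expectation when $f$ is measurable. -/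

import Mathlib

open MeasureTheory ProbabilityTheory Set
open scoped ENNReal NNReal

noncomputable section

namespace FPP

/-- The Euclidean plane. -/
abbrev Plane : Type := EuclideanSpace ℝ (Fin 2)

/-- `η` is a homogeneous Poisson point process of unit intensity on the plane, defined on the
probability space `(Ω, P)`: `η w` is a locally finite set of points, the number of points in a
bounded Borel set `B` is a Poisson random variable whose mean is the area of `B`, and the numbers
of points in disjoint bounded Borel sets are independent. -/
structure IsPoissonProcess {Ω : Type*} [MeasurableSpace Ω] (P : Measure Ω)
    (η : Ω → Set Plane) : Prop where
  locallyFinite : ∀ (w : Ω) (B : Set Plane), Bornology.IsBounded B → (η w ∩ B).Finite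
  measurable_count : ∀ B : Set Plane, MeasurableSet B → Bornology.IsBounded B →
    Measurable fun w => (η w ∩ B).ncard
  map_count : ∀ B : Set Plane, MeasurableSet B → Bornology.IsBounded B →
    P.map (fun w => (η w ∩ B).ncard) = poissonMeasure (volume B).toNNReal
  indep_count : ∀ (m : ℕ) (B : Fin m → Set Plane),
    (∀ i, MeasurableSet (B i)) → (∀ i, Bornology.IsBounded (B i)) →
    (Pairwise fun i j => Disjoint (B i) (B j)) →
    iIndepFun (fun i w => (η w ∩ B i).ncard) P

/-- `γ` restricted to `[0, s]` is a (continuous) piecewise linear path. The closed pieces share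
their end points, so continuity is automatic. Values of `γ` outside `[0, s]` play no role. -/
def IsPiecewiseLinear (s : ℝ) (γ : ℝ → Plane) : Prop :=
  ∃ (n : ℕ) (τ : ℕ → ℝ), τ 0 = 0 ∧ τ n = s ∧ (∀ i < n, τ i < τ (i + 1)) ∧
    ∀ i < n, ∃ a v : Plane, ∀ u ∈ Icc (τ i) (τ (i + 1)), γ u = a + u • v

/-- The piecewise linear paths on `[0, s]` that visit every point of the configuration `ω` at
most once. -/
def paths (ω : Set Plane) (s : ℝ) : Set (ℝ → Plane) :=
  {γ | IsPiecewiseLinear s γ ∧ ∀ p ∈ ω, {u | u ∈ Icc 0 s ∧ γ u = p}.Subsingleton}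

/-- The points of the configuration `ω` touched by the path `γ` on `[0, s]`. -/
def touchedPoints (ω : Set Plane) (s : ℝ) (γ : ℝ → Plane) : Set Plane :=
  ω ∩ γ '' Icc 0 s

/-- The action of a path: kinetic energy minus the number of points of `ω` touched. -/
def pathAction (ω : Set Plane) (s : ℝ) (γ : ℝ → Plane) : ℝ :=
  (1 / 2) * (∫ u in (0 : ℝ)..s, ‖deriv γ u‖ ^ 2) - ((touchedPoints ω s γ).ncard : ℝ)

/-- The total length of a piecewise linear path on `[0, s]`. -/
def pathLength (s : ℝ) (γ : ℝ → Plane) : ℝ :=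
  ∫ u in (0 : ℝ)..s, ‖deriv γ u‖

/-- The paths competing in the definition of the action between `x` and `S`. -/
def pathsTo (ω : Set Plane) (s : ℝ) (x : Plane) (S : Set Plane) : Set (ℝ → Plane) :=
  {γ | γ ∈ paths ω s ∧ γ 0 = x ∧ γ s ∈ S}

/-- The action between the point `x` and the set `S` in time `s`; the infimum is taken in the
extended reals. -/
def action (ω : Set Plane) (s : ℝ) (x : Plane) (S : Set Plane) : EReal :=
  ⨅ γ ∈ pathsTo ω s x S, (pathAction ω s γ : EReal)

/-- `γ` attains the infimum defining the action between `x` and `S` in time `s`. -/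
def IsMinimizer (ω : Set Plane) (s : ℝ) (x : Plane) (S : Set Plane) (γ : ℝ → Plane) : Prop :=
  γ ∈ pathsTo ω s x S ∧ (pathAction ω s γ : EReal) = action ω s x S

/-- The half-open unit square centred at the lattice point `z`. -/
def unitSquare (z : ℤ × ℤ) : Set Plane :=
  {x | x 0 ∈ Ico ((z.1 : ℝ) - 1 / 2) ((z.1 : ℝ) + 1 / 2) ∧
    x 1 ∈ Ico ((z.2 : ℝ) - 1 / 2) ((z.2 : ℝ) + 1 / 2)}

/-- The (indices of the) unit squares in which the path `γ` touches a point of `ω`. -/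
def touchedSquares (ω : Set Plane) (s : ℝ) (γ : ℝ → Plane) : Set (ℤ × ℤ) :=
  {z | (touchedPoints ω s γ ∩ unitSquare z).Nonempty}

/-- The (indices of the) unit squares which the path `γ` passes through. -/
def passedSquares (s : ℝ) (γ : ℝ → Plane) : Set (ℤ × ℤ) :=
  {z | (γ '' Icc 0 s ∩ unitSquare z).Nonempty}

/-- The nearest-neighbour graph on the square lattice. -/
def latticeGraph : SimpleGraph (ℤ × ℤ) where
  Adj z z' := |z.1 - z'.1| + |z.2 - z'.2| = 1
  symm := ⟨fun z z' h => by rwa [abs_sub_comm z'.1, abs_sub_comm z'.2]⟩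
  loopless := ⟨fun z h => by simp at h⟩

/-- A lattice animal: a finite connected set of lattice points that contains the origin. -/
def IsLatticeAnimal (𝒜 : Finset (ℤ × ℤ)) : Prop :=
  (0, 0) ∈ 𝒜 ∧ (latticeGraph.induce (𝒜 : Set (ℤ × ℤ))).Connected

/-- The weight of the greedy lattice animal of size `n`, the weight of a lattice point being the
number of points of `ω` in its unit square. There are finitely many lattice animals of size `n`,
so the supremum is a maximum; it is `0` for `n = 0`. -/
def greedyWeight (ω : Set Plane) (n : ℕ) : ℝ≥0∞ :=
  ⨆ (𝒜 : Finset (ℤ × ℤ)) (_ : IsLatticeAnimal 𝒜) (_ : 𝒜.card = n),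
    ∑ z ∈ 𝒜, ((ω ∩ unitSquare z).ncard : ℝ≥0∞)

/-- The expectation of a nonnegative function, in the form of an upper integral, so that it bounds
also functions that are not known to be measurable (`lintegral` would be a lower integral). -/
def upperExp {Ω : Type*} [MeasurableSpace Ω] (P : Measure Ω) (f : Ω → ℝ≥0∞) : ℝ≥0∞ :=
  ⨅ (g : Ω → ℝ≥0∞) (_ : Measurable g) (_ : f ≤ᵐ[P] g), ∫⁻ w, g w ∂P

/-- For measurable functions, the upper expectation is the expectation. -/
theorem upperExp_eq_lintegral {Ω : Type*} [MeasurableSpace Ω] (P : Measure Ω) (f : Ω → ℝ≥0∞)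
    (hf : AEMeasurable f P) : upperExp P f = ∫⁻ w, f w ∂P := by
  refine le_antisymm ?_ ?_
  · rw [lintegral_congr_ae hf.ae_eq_mk]
    exact iInf_le_of_le (hf.mk f) (iInf_le_of_le hf.measurable_mk
      (iInf_le_of_le hf.ae_eq_mk.le le_rfl))
  · exact le_iInf fun g => le_iInf fun _ => le_iInf fun h => lintegral_mono_ae h

end FPP

end

/-!
The action of a path `γ` of length `L` in time `s` is at least `L ^ 2 / (2 s)` (Cauchy–Schwarz)
minus the number of points of `ω` on `γ`. A path of length `L` from the origin is covered by a
lattice animal with at most `9 (L + 1)` elements (`IsPiecewiseLinear.exists_animal`), so this number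
is at most the weight of such an animal, the number of points of `ω` in its squares.

All lattice animals are controlled at once by a single random variable. An animal with `n` elements
is the range of a lattice walk with at most `2 n` steps (`IsLatticeAnimal.exists_visited_eq`), there
are `4 ^ j` walks with `j` steps, and the weight of a set of `n` squares, a sum of independent
Poisson variables, has an exponential moment `M ^ n`. Hence for large `K` the sum `Z` of
`exp (N - K j)` over all walks, where `N` is the weight of the range and `j` the number of steps,
has a finite expectation (`exists_lintegral_walkPartition_le`). With `X = log (1 + Z)`, every animal
`A` has weight at most `2 K |A| + X` (`IsLatticeAnimal.sum_ncard_le`), and all moments of `X` are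
finite.

The rest is deterministic. The straight line to `y` has action at most `t / (2 c)` in time `c t`;
the lower bound `L ^ 2 / (2 c t) - κ (L + 1) - X` for every path then gives
`|action| ≤ D (t / c) (1 + X)`, and for a minimizer `L ^ 2 ≤ D t ^ 2 (1 + X)`. The numbers of
squares obey the same quadratic bound, and the greedy weight is at most `D t (1 + X)`. Since
`(1 + X) ^ k ≤ k! e (1 + Z)`, these pointwise bounds have measurable majorants with the right
expectations, whether or not the functions themselves are measurable.
-/

namespace FPP

/-! ### Piecewise linear paths -/

theorem hasDerivAt_of_eqOn_Icc_affine {γ : ℝ → Plane} {p q : ℝ} {a v : Plane}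
    (h : ∀ u ∈ Icc p q, γ u = a + u • v) {u : ℝ} (hu : u ∈ Ioo p q) : HasDerivAt γ v u := by
  have h1 : HasDerivAt (fun u : ℝ => a + u • v) v u := by
    simpa using ((hasDerivAt_id u).smul_const v).const_add a
  refine h1.congr_of_eventuallyEq ?_
  filter_upwards [Icc_mem_nhds hu.1 hu.2] with x hx using h x hx

theorem IsPiecewiseLinear.continuousOn {s : ℝ} {γ : ℝ → Plane} (h : IsPiecewiseLinear s γ) :
    ContinuousOn γ (Icc 0 s) := by
  obtain ⟨n, τ, h0, rfl, hlt, hlin⟩ := h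
  have key : ∀ j ≤ n, 0 ≤ τ j ∧ ContinuousOn γ (Icc 0 (τ j)) := by
    intro j
    induction j with
    | zero => simp [h0]
    | succ j ih =>
      intro hj
      obtain ⟨h1, h2⟩ := ih (by omega)
      have h3 := hlt j (by omega)
      obtain ⟨a, v, hav⟩ := hlin j (by omega)
      refine ⟨by linarith, ?_⟩
      rw [← Icc_union_Icc_eq_Icc h1 h3.le]
      refine h2.union_of_isClosed ?_ isClosed_Icc isClosed_Icc
      exact ContinuousOn.congr (by fun_prop) hav
  exact (key n le_rfl).2

theorem IsPiecewiseLinear.exists_countable_differentiableAt {s : ℝ} {γ : ℝ → Plane}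
    (h : IsPiecewiseLinear s γ) :
    ∃ T : Set ℝ, T.Countable ∧ ∀ u ∈ Ioo 0 s \ T, DifferentiableAt ℝ γ u := by
  obtain ⟨n, τ, h0, rfl, hlt, hlin⟩ := h
  refine ⟨range τ, countable_range τ, ?_⟩
  have key : ∀ j ≤ n, ∀ u ∈ Ioo 0 (τ j) \ range τ, DifferentiableAt ℝ γ u := by
    intro j
    induction j with
    | zero => simp [h0]
    | succ j ih =>
      rintro hj u ⟨⟨hu0, hu1⟩, huT⟩
      rcases lt_trichotomy u (τ j) with hu | hu | hu
      · exact ih (by omega) u ⟨⟨hu0, hu⟩, huT⟩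
      · exact absurd ⟨j, hu.symm⟩ huT
      · obtain ⟨a, v, hav⟩ := hlin j (by omega)
        exact (hasDerivAt_of_eqOn_Icc_affine hav ⟨hu, hu1⟩).differentiableAt
  exact key n le_rfl

/-- The velocity of a piecewise linear path is a step function, so every function of it is
integrable. -/
theorem IsPiecewiseLinear.intervalIntegrable_comp_deriv {F : Type*} [NormedAddCommGroup F]
    {s : ℝ} {γ : ℝ → Plane} (h : IsPiecewiseLinear s γ) (g : Plane → F) :
    IntervalIntegrable (fun u => g (deriv γ u)) volume 0 s := by
  obtain ⟨n, τ, h0, rfl, hlt, hlin⟩ := h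
  rw [← h0]
  refine IntervalIntegrable.trans_iterate fun i hi => ?_
  obtain ⟨a, v, hav⟩ := hlin i hi
  have hle := (hlt i hi).le
  rw [intervalIntegrable_iff_integrableOn_Ioo_of_le hle]
  refine (integrableOn_const (C := g v) (by simp) (by simp)).congr_fun (fun u hu => ?_)
    measurableSet_Ioo
  simp only [(hasDerivAt_of_eqOn_Icc_affine hav hu).deriv]

theorem IsPiecewiseLinear.nonneg {s : ℝ} {γ : ℝ → Plane} (h : IsPiecewiseLinear s γ) :
    0 ≤ s := by
  obtain ⟨n, τ, h0, rfl, hlt, -⟩ := h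
  have key : ∀ j ≤ n, 0 ≤ τ j := by
    intro j
    induction j with
    | zero => simp [h0]
    | succ j ih => exact fun hj => (ih (by omega)).trans (hlt j (by omega)).le
  exact key n le_rfl

theorem pathLength_nonneg {s : ℝ} (hs : 0 ≤ s) (γ : ℝ → Plane) : 0 ≤ pathLength s γ :=
  intervalIntegral.integral_nonneg hs fun _ _ => norm_nonneg _

theorem IsPiecewiseLinear.norm_sub_le {s : ℝ} {γ : ℝ → Plane} (h : IsPiecewiseLinear s γ)
    {u v : ℝ} (hu : 0 ≤ u) (huv : u ≤ v) (hv : v ≤ s) :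
    ‖γ v - γ u‖ ≤ pathLength v γ - pathLength u γ := by
  obtain ⟨T, hT, hdiff⟩ := h.exists_countable_differentiableAt
  have hs := h.nonneg
  have sub : ∀ {p q : ℝ}, 0 ≤ p → p ≤ q → q ≤ s → uIcc p q ⊆ uIcc 0 s := fun hp hpq hq => by
    rw [uIcc_of_le hpq, uIcc_of_le hs]; exact Icc_subset_Icc hp hq
  have hint := (h.intervalIntegrable_comp_deriv id).mono_set (sub hu huv hv)
  have hnorm : ∀ {p q : ℝ}, 0 ≤ p → p ≤ q → q ≤ s →
      IntervalIntegrable (fun u => ‖deriv γ u‖) volume p q := fun hp hpq hq =>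
    (h.intervalIntegrable_comp_deriv fun x => ‖x‖).mono_set (sub hp hpq hq)
  have hftc : ∫ x in u..v, deriv γ x = γ v - γ u := by
    refine integral_eq_of_hasDerivAt_off_countable γ (deriv γ) hT ?_ ?_ hint
    · rw [uIcc_of_le huv]
      exact h.continuousOn.mono (Icc_subset_Icc hu hv)
    · rintro x ⟨hx, hxT⟩
      rw [min_eq_left huv, max_eq_right huv] at hx
      exact (hdiff x ⟨⟨hu.trans_lt hx.1, hx.2.trans_le hv⟩, hxT⟩).hasDerivAt
  rw [← hftc, pathLength, pathLength, intervalIntegral.integral_interval_sub_left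
    (hnorm le_rfl (hu.trans huv) hv) (hnorm le_rfl hu (huv.trans hv))]
  exact intervalIntegral.norm_integral_le_integral_norm huv

/-- The Cauchy–Schwarz inequality between the length and the kinetic energy. -/
theorem IsPiecewiseLinear.sq_pathLength_le {s : ℝ} {γ : ℝ → Plane}
    (h : IsPiecewiseLinear s γ) (hs : 0 < s) :
    pathLength s γ ^ 2 / s ≤ ∫ u in (0 : ℝ)..s, ‖deriv γ u‖ ^ 2 := by
  have i1 := h.intervalIntegrable_comp_deriv fun x => ‖x‖
  have i2 := h.intervalIntegrable_comp_deriv fun x => ‖x‖ ^ 2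
  set m := pathLength s γ / s with hm
  have h0 : 0 ≤ ∫ u in (0 : ℝ)..s, (‖deriv γ u‖ - m) ^ 2 :=
    intervalIntegral.integral_nonneg hs.le fun _ _ => sq_nonneg _
  have h1 : ∫ u in (0 : ℝ)..s, (‖deriv γ u‖ - m) ^ 2 =
      (∫ u in (0 : ℝ)..s, ‖deriv γ u‖ ^ 2) - 2 * m * pathLength s γ + m ^ 2 * s := by
    have : ∀ u, (‖deriv γ u‖ - m) ^ 2 = ‖deriv γ u‖ ^ 2 - 2 * m * ‖deriv γ u‖ + m ^ 2 :=
      fun u => by ring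
    simp_rw [this]
    rw [intervalIntegral.integral_add (i2.sub (i1.const_mul _)) (by simp),
      intervalIntegral.integral_sub i2 (i1.const_mul _), intervalIntegral.integral_const_mul,
      intervalIntegral.integral_const, pathLength]
    simp [mul_comm]
  rw [h1] at h0
  have h2 : 2 * m * pathLength s γ - m ^ 2 * s = pathLength s γ ^ 2 / s := by
    rw [hm]; field_simp; ring
  linarith

theorem IsPiecewiseLinear.continuousOn_pathLength {s : ℝ} {γ : ℝ → Plane}
    (h : IsPiecewiseLinear s γ) : ContinuousOn (fun u => pathLength u γ) (Icc 0 s) := by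
  have := intervalIntegral.continuousOn_primitive_interval' (a := 0)
    (h.intervalIntegrable_comp_deriv fun x => ‖x‖) left_mem_uIcc
  rwa [uIcc_of_le h.nonneg] at this

/-- A path of length `L` stays within distance one of `⌊L⌋ + 1` of its points, of which the first
is its starting point and successive ones have distance at most one. -/
theorem IsPiecewiseLinear.exists_net {s : ℝ} {γ : ℝ → Plane} (h : IsPiecewiseLinear s γ) :
    ∃ p : ℕ → Plane, p 0 = γ 0 ∧
      (∀ i < ⌊pathLength s γ⌋₊, ‖p (i + 1) - p i‖ ≤ 1) ∧
      ∀ u ∈ Icc 0 s, ∃ i ≤ ⌊pathLength s γ⌋₊, ‖γ u - p i‖ ≤ 1 := by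
  have hs := h.nonneg
  have hL := pathLength_nonneg hs γ
  have hzero : pathLength 0 γ = 0 := by simp [pathLength]
  have hdist : ∀ {u v}, u ∈ Icc 0 s → v ∈ Icc 0 s →
      ‖γ v - γ u‖ ≤ |pathLength v γ - pathLength u γ| := by
    intro u v hu hv
    rcases le_total u v with huv | huv
    · exact (h.norm_sub_le hu.1 huv hv.2).trans (le_abs_self _)
    · rw [norm_sub_rev, abs_sub_comm]
      exact (h.norm_sub_le hv.1 huv hu.2).trans (le_abs_self _)
  have hmem : ∀ i ≤ ⌊pathLength s γ⌋₊, ∃ u ∈ Icc 0 s, pathLength u γ = i := by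
    intro i hi
    have := intermediate_value_Icc hs h.continuousOn_pathLength
    obtain ⟨u, hu, hui⟩ := this ⟨by simp [hzero], (Nat.le_floor_iff hL).1 hi⟩
    exact ⟨u, hu, hui⟩
  choose! u hu hui using hmem
  refine ⟨fun i => γ (u i), ?_, ?_, ?_⟩
  · have := hdist (left_mem_Icc.2 hs) (hu 0 (Nat.zero_le _))
    rw [hui 0 (Nat.zero_le _), hzero] at this
    simpa [sub_eq_zero] using this
  · intro i hi
    refine (hdist (hu i hi.le) (hu (i + 1) hi)).trans ?_
    rw [hui i hi.le, hui (i + 1) hi]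
    simp
  · intro v hv
    have hv0 : 0 ≤ pathLength v γ := pathLength_nonneg hv.1 γ
    have hle : ⌊pathLength v γ⌋₊ ≤ ⌊pathLength s γ⌋₊ := Nat.floor_mono (by
      have := (norm_nonneg _).trans (h.norm_sub_le hv.1 hv.2 le_rfl)
      linarith)
    refine ⟨_, hle, (hdist (hu _ hle) hv).trans ?_⟩
    rw [hui _ hle, abs_le]
    constructor <;> linarith [Nat.floor_le hv0, Nat.lt_floor_add_one (pathLength v γ)]

/-! ### Covering a path by a lattice animal -/

/-- The index of the unit square that contains `x`. -/
noncomputable def cell (x : Plane) : ℤ × ℤ := (⌊x 0 + 1 / 2⌋, ⌊x 1 + 1 / 2⌋)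

theorem mem_unitSquare_iff {x : Plane} {z : ℤ × ℤ} : x ∈ unitSquare z ↔ cell x = z := by
  simp only [unitSquare, cell, mem_ofPred_eq, mem_Ico, Prod.ext_iff, Int.floor_eq_iff]
  constructor <;> rintro ⟨⟨_, _⟩, _, _⟩ <;> refine ⟨⟨?_, ?_⟩, ?_, ?_⟩ <;> linarith

theorem mem_unitSquare_cell (x : Plane) : x ∈ unitSquare (cell x) := mem_unitSquare_iff.2 rfl

/-- The `3 × 3` box around a lattice point. -/
noncomputable def box (z : ℤ × ℤ) : Finset (ℤ × ℤ) :=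
  Finset.Icc (z.1 - 1) (z.1 + 1) ×ˢ Finset.Icc (z.2 - 1) (z.2 + 1)

theorem card_box (z : ℤ × ℤ) : (box z).card = 9 := by
  simp only [box, Finset.card_product, Int.card_Icc]
  ring_nf
  rfl

theorem mem_box {z z' : ℤ × ℤ} :
    z' ∈ box z ↔ (z.1 - 1 ≤ z'.1 ∧ z'.1 ≤ z.1 + 1) ∧ z.2 - 1 ≤ z'.2 ∧ z'.2 ≤ z.2 + 1 := by
  simp [box]

theorem cell_mem_box {x y : Plane} (h : ‖x - y‖ ≤ 1) : cell x ∈ box (cell y) := by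
  have key : ∀ {a b : ℝ}, |a - b| ≤ 1 →
      ⌊b + 1 / 2⌋ - 1 ≤ ⌊a + 1 / 2⌋ ∧ ⌊a + 1 / 2⌋ ≤ ⌊b + 1 / 2⌋ + 1 := by
    intro a b hab
    obtain ⟨h1, h2⟩ := abs_le.1 hab
    rw [← Int.floor_sub_one, ← Int.floor_add_one]
    exact ⟨Int.floor_mono (by linarith), Int.floor_mono (by linarith)⟩
  have hc : ∀ i, |x i - y i| ≤ 1 := fun i => by
    simpa using (PiLp.norm_apply_le (x - y) i).trans h
  exact mem_box.2 ⟨key (hc 0), key (hc 1)⟩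

theorem reachable_induce_of_adj_or_eq {S : Set (ℤ × ℤ)} {z z' : ℤ × ℤ} (hz : z ∈ S) (hz' : z' ∈ S)
    (h : |z.1 - z'.1| + |z.2 - z'.2| ≤ 1) :
    (latticeGraph.induce S).Reachable ⟨z, hz⟩ ⟨z', hz'⟩ := by
  by_cases heq : z = z'
  · subst heq; rfl
  · refine SimpleGraph.Adj.reachable ?_
    have : z.1 ≠ z'.1 ∨ z.2 ≠ z'.2 := by
      by_contra! hc
      exact heq (Prod.ext hc.1 hc.2)
    change |z.1 - z'.1| + |z.2 - z'.2| = 1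
    rcases this with h1 | h1
    · have := abs_pos.2 (sub_ne_zero.2 h1)
      have := abs_nonneg (z.2 - z'.2)
      omega
    · have := abs_pos.2 (sub_ne_zero.2 h1)
      have := abs_nonneg (z.1 - z'.1)
      omega

theorem reachable_induce_of_mem_box {S : Set (ℤ × ℤ)} {z z' : ℤ × ℤ} (hS : ↑(box z) ⊆ S)
    (h : z' ∈ box z) (hz : z ∈ S) :
    (latticeGraph.induce S).Reachable ⟨z, hz⟩ ⟨z', hS h⟩ := by
  obtain ⟨⟨h1, h2⟩, h3, h4⟩ := mem_box.1 h
  -- Two steps: a horizontal one to the column of `z'`, then a vertical one.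
  have hmid : (z'.1, z.2) ∈ S := hS (mem_box.2 ⟨⟨h1, h2⟩, by simp, by simp⟩)
  refine (reachable_induce_of_adj_or_eq hz hmid ?_).trans
    (reachable_induce_of_adj_or_eq hmid (hS h) ?_)
  · simpa using abs_le.2 ⟨by linarith, by linarith⟩
  · simpa using abs_le.2 ⟨by linarith, by linarith⟩

theorem isLatticeAnimal_biUnion_box {r : ℕ → ℤ × ℤ} {m : ℕ} (h0 : r 0 = (0, 0))
    (hr : ∀ i < m, r (i + 1) ∈ box (r i)) :
    IsLatticeAnimal ((Finset.range (m + 1)).biUnion fun i => box (r i)) := by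
  set A := (Finset.range (m + 1)).biUnion fun i => box (r i)
  have hself : ∀ z, z ∈ box z := fun z => mem_box.2 (by simp)
  have hsub : ∀ i ≤ m, (box (r i) : Set (ℤ × ℤ)) ⊆ (A : Set (ℤ × ℤ)) := fun i hi =>
    Finset.coe_subset.2 (Finset.subset_biUnion_of_mem (fun i => box (r i))
      (Finset.mem_range.2 (by omega)))
  have hmem : ∀ i ≤ m, r i ∈ (A : Set (ℤ × ℤ)) := fun i hi => hsub i hi (hself _)
  have hreach : ∀ i (hi : i ≤ m), (latticeGraph.induce (A : Set (ℤ × ℤ))).Reachable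
      ⟨r 0, hmem 0 (Nat.zero_le _)⟩ ⟨r i, hmem i hi⟩ := by
    intro i
    induction i with
    | zero => exact fun _ => .rfl
    | succ i ih =>
      intro hi
      exact (ih (by omega)).trans (reachable_induce_of_mem_box (hsub i (by omega)) (hr i hi) _)
  refine ⟨h0 ▸ hmem 0 (Nat.zero_le _), (SimpleGraph.connected_iff_exists_forall_reachable _).2
    ⟨⟨r 0, hmem 0 (Nat.zero_le _)⟩, ?_⟩⟩
  rintro ⟨z, hz⟩
  obtain ⟨i, hi, hzi⟩ := Finset.mem_biUnion.1 (Finset.mem_coe.1 hz)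
  have hi' : i ≤ m := Nat.lt_succ_iff.1 (Finset.mem_range.1 hi)
  exact (hreach i hi').trans (reachable_induce_of_mem_box (hsub i hi') hzi _)

/-- A path of length `L` from the origin is covered by a lattice animal with at most `9 (L + 1)`
elements. -/
theorem IsPiecewiseLinear.exists_animal {s : ℝ} {γ : ℝ → Plane} (h : IsPiecewiseLinear s γ)
    (h0 : γ 0 = 0) :
    ∃ A : Finset (ℤ × ℤ), IsLatticeAnimal A ∧ (A.card : ℝ) ≤ 9 * (pathLength s γ + 1) ∧
      passedSquares s γ ⊆ A := by
  obtain ⟨p, hp0, hp, hcov⟩ := h.exists_net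
  set m := ⌊pathLength s γ⌋₊ with hm
  refine ⟨_, isLatticeAnimal_biUnion_box (r := fun i => cell (p i)) (m := m) ?_
    (fun i hi => cell_mem_box (hp i hi)), ?_, ?_⟩
  · norm_num [hp0, h0, cell]
  · have h1 := Finset.card_biUnion_le (s := Finset.range (m + 1)) (t := fun i => box (cell (p i)))
    simp only [card_box, Finset.sum_const, Finset.card_range, smul_eq_mul] at h1
    have h2 : (m : ℝ) ≤ pathLength s γ := Nat.floor_le (pathLength_nonneg h.nonneg γ)
    calc _ ≤ (((m + 1) * 9 : ℕ) : ℝ) := by exact_mod_cast h1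
      _ = 9 * ((m : ℝ) + 1) := by push_cast; ring
      _ ≤ _ := by linarith
  · rintro z ⟨x, ⟨u, hu, rfl⟩, hx⟩
    obtain ⟨i, hi, hle⟩ := hcov u hu
    rw [← mem_unitSquare_iff.1 hx]
    exact Finset.mem_coe.2 (Finset.mem_biUnion.2
      ⟨i, Finset.mem_range.2 (Nat.lt_succ_of_le hi), cell_mem_box hle⟩)

theorem touchedSquares_subset_passedSquares (ω : Set Plane) (s : ℝ) (γ : ℝ → Plane) :
    touchedSquares ω s γ ⊆ passedSquares s γ := fun _ ⟨x, hx, hxz⟩ => ⟨x, hx.2, hxz⟩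

theorem IsPiecewiseLinear.ncard_touchedSquares_le {s : ℝ} {γ : ℝ → Plane}
    (h : IsPiecewiseLinear s γ) (ω : Set Plane) (h0 : γ 0 = 0) :
    (touchedSquares ω s γ).ncard ≤ (passedSquares s γ).ncard := by
  obtain ⟨A, -, -, hsub⟩ := h.exists_animal h0
  exact ncard_le_ncard (touchedSquares_subset_passedSquares ω s γ) (A.finite_toSet.subset hsub)

theorem isBounded_unitSquare (z : ℤ × ℤ) : Bornology.IsBounded (unitSquare z) := by
  refine (Metric.isBounded_iff_subset_closedBall (!₂[(z.1 : ℝ), (z.2 : ℝ)])).2 ⟨1, ?_⟩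
  rintro x ⟨⟨h1, h2⟩, h3, h4⟩
  rw [Metric.mem_closedBall, EuclideanSpace.dist_eq, Real.sqrt_le_one]
  simp only [Fin.sum_univ_two, Real.dist_eq, sq_abs]
  simp
  nlinarith

theorem ncard_touchedPoints_le {ω : Set Plane} {s : ℝ} {γ : ℝ → Plane}
    (hω : ∀ B, Bornology.IsBounded B → (ω ∩ B).Finite) {A : Finset (ℤ × ℤ)}
    (hA : passedSquares s γ ⊆ A) :
    (touchedPoints ω s γ).ncard ≤ ∑ z ∈ A, (ω ∩ unitSquare z).ncard := by
  have hfin : ∀ z, (ω ∩ unitSquare z).Finite := fun z => hω _ (isBounded_unitSquare z)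
  have hsub : touchedPoints ω s γ ⊆ ⋃ z ∈ A, ω ∩ unitSquare z := by
    rintro x ⟨hx, hxγ⟩
    exact mem_iUnion₂.2 ⟨cell x, hA ⟨x, hxγ, mem_unitSquare_cell x⟩, hx, mem_unitSquare_cell x⟩
  refine (ncard_le_ncard hsub (A.finite_toSet.biUnion fun z _ => hfin z)).trans ?_
  exact Finset.set_ncard_biUnion_le A fun z => ω ∩ unitSquare z

/-! ### Lattice animals as ranges of lattice walks -/

/-- The four steps of a nearest-neighbour walk. -/
def step : Fin 4 → ℤ × ℤ := ![(1, 0), (-1, 0), (0, 1), (0, -1)]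

/-- The set of lattice points visited by the walk from `z` with the given steps. -/
def visited : ℤ × ℤ → List (Fin 4) → Finset (ℤ × ℤ)
  | z, [] => {z}
  | z, d :: l => insert z (visited (z + step d) l)

theorem card_visited_le (z : ℤ × ℤ) (l : List (Fin 4)) : (visited z l).card ≤ l.length + 1 := by
  induction l generalizing z with
  | nil => simp [visited]
  | cons d l ih => exact (Finset.card_insert_le _ _).trans (Nat.succ_le_succ (ih _))

theorem exists_step_of_adj {z z' : ℤ × ℤ} (h : latticeGraph.Adj z z') :
    ∃ d, z' = z + step d := by
  have h : |z.1 - z'.1| + |z.2 - z'.2| = 1 := h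
  obtain ⟨a, b⟩ := z
  obtain ⟨a', b'⟩ := z'
  simp only at h
  have : (a' = a + 1 ∧ b' = b) ∨ (a' = a - 1 ∧ b' = b) ∨ (a' = a ∧ b' = b + 1) ∨
      (a' = a ∧ b' = b - 1) := by
    rcases abs_cases (a - a') with ⟨h1, _⟩ | ⟨h1, _⟩ <;>
      rcases abs_cases (b - b') with ⟨h2, _⟩ | ⟨h2, _⟩ <;> omega
  rcases this with ⟨rfl, rfl⟩ | ⟨rfl, rfl⟩ | ⟨rfl, rfl⟩ | ⟨rfl, rfl⟩
  · exact ⟨0, by simp [step]⟩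
  · exact ⟨1, by simp [step, sub_eq_add_neg]⟩
  · exact ⟨2, by simp [step]⟩
  · exact ⟨3, by simp [step, sub_eq_add_neg]⟩

theorem exists_visited_eq_support {z z' : ℤ × ℤ} (w : latticeGraph.Walk z z') :
    ∃ l : List (Fin 4), l.length = w.length ∧ visited z l = w.support.toFinset := by
  induction w with
  | nil => exact ⟨[], by simp [visited]⟩
  | cons h p ih =>
    obtain ⟨l, hl, hv⟩ := ih
    obtain ⟨d, rfl⟩ := exists_step_of_adj h
    exact ⟨d :: l, by simp [hl], by simp [visited, hv]⟩

/-- Walking around a subtree: for every `m < |A|`, a lattice animal `A` contains a closed walk from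
the origin that visits `m + 1` points in `2 m` steps. -/
theorem IsLatticeAnimal.exists_walk {A : Finset (ℤ × ℤ)} (hA : IsLatticeAnimal A) (m : ℕ)
    (hm : m < A.card) :
    ∃ w : latticeGraph.Walk (0, 0) (0, 0), w.length = 2 * m ∧ w.support.toFinset ⊆ A ∧
      w.support.toFinset.card = m + 1 := by
  induction m with
  | zero => exact ⟨.nil, by simpa using hA.1⟩
  | succ m ih =>
    obtain ⟨w, hlen, hsub, hcard⟩ := ih (by omega)
    obtain ⟨y, hyA, hyw⟩ : ∃ y ∈ A, y ∉ w.support.toFinset := by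
      by_contra! hc
      have := Finset.card_le_card hc
      omega
    -- An edge of the animal leads out of the part already visited; walk there and back.
    obtain ⟨q⟩ := hA.2.preconnected ⟨(0, 0), hA.1⟩ ⟨y, hyA⟩
    obtain ⟨e, -, he1, he2⟩ := q.exists_boundary_dart {x | x.1 ∈ w.support.toFinset}
      (by simp) hyw
    have hadj : latticeGraph.Adj e.fst.1 e.snd.1 := e.adj
    have h1 : e.fst.1 ∈ w.support := List.mem_toFinset.1 he1
    have h2 : e.snd.1 ∉ w.support.toFinset := he2
    set w' := (w.takeUntil _ h1).append
      (.cons hadj (.cons hadj.symm (w.dropUntil _ h1))) with hw'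
    have hsupp : w'.support.toFinset = insert e.snd.1 w.support.toFinset := by
      ext x
      have hx : x ∈ w.support ↔
          x ∈ (w.takeUntil _ h1).support ∨ x ∈ (w.dropUntil _ h1).support := by
        rw [← SimpleGraph.Walk.mem_support_append_iff, SimpleGraph.Walk.take_spec]
      have h3 := (w.dropUntil _ h1).start_mem_support
      simp only [hw', List.mem_toFinset, SimpleGraph.Walk.mem_support_append_iff,
        SimpleGraph.Walk.support_cons, List.mem_cons, Finset.mem_insert, hx]
      constructor
      · rintro (h | rfl | rfl | h) <;> simp_all
      · rintro (rfl | h | h) <;> simp_all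
    refine ⟨w', ?_, ?_, ?_⟩
    · have := congrArg SimpleGraph.Walk.length (w.take_spec h1)
      simp only [SimpleGraph.Walk.length_append] at this
      simp only [hw', SimpleGraph.Walk.length_append, SimpleGraph.Walk.length_cons]
      omega
    · rw [hsupp]
      exact Finset.insert_subset e.snd.2 hsub
    · rw [hsupp, Finset.card_insert_of_notMem h2, hcard]

theorem IsLatticeAnimal.exists_visited_eq {A : Finset (ℤ × ℤ)} (hA : IsLatticeAnimal A) :
    ∃ l : List (Fin 4), l.length ≤ 2 * A.card ∧ visited (0, 0) l = A := by
  have hpos : 0 < A.card := Finset.card_pos.2 ⟨_, hA.1⟩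
  obtain ⟨w, hlen, hsub, hcard⟩ := hA.exists_walk (A.card - 1) (by omega)
  obtain ⟨l, hl, hv⟩ := exists_visited_eq_support w
  exact ⟨l, by omega, hv.trans (Finset.eq_of_subset_of_card_le hsub (by omega))⟩

/-! ### Exponential moments of the weights of lattice animals -/

theorem volume_unitSquare (z : ℤ × ℤ) : volume (unitSquare z) = 1 := by
  have h : unitSquare z = WithLp.ofLp ⁻¹' (Set.pi univ
      (![Ico ((z.1 : ℝ) - 1 / 2) ((z.1 : ℝ) + 1 / 2), Ico ((z.2 : ℝ) - 1 / 2) ((z.2 : ℝ) + 1 / 2)] :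
        Fin 2 → Set ℝ)) := by
    ext x
    simp [unitSquare]
  rw [h, (PiLp.volume_preserving_ofLp (Fin 2)).measure_preimage, volume_pi_pi]
  · norm_num [Fin.prod_univ_two]
  · refine (MeasurableSet.univ_pi fun i => ?_).nullMeasurableSet
    fin_cases i <;> exact measurableSet_Ico

theorem measurableSet_unitSquare (z : ℤ × ℤ) : MeasurableSet (unitSquare z) := by
  have h : ∀ i : Fin 2, Measurable fun x : Plane => x i := fun i => by fun_prop
  exact ((h 0) measurableSet_Ico).inter ((h 1) measurableSet_Ico)

theorem pairwise_disjoint_unitSquare : Pairwise fun z z' => Disjoint (unitSquare z) (unitSquare z') :=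
  fun _ _ hne => disjoint_left.2 fun _ hx hx' =>
    hne ((mem_unitSquare_iff.1 hx).symm.trans (mem_unitSquare_iff.1 hx'))

/-- The exponential moment of a Poisson random variable of mean one. -/
noncomputable def poissonExpMoment : ℝ≥0∞ := ∫⁻ n, ENNReal.ofReal (Real.exp n) ∂(poissonMeasure 1)

theorem one_le_poissonExpMoment : 1 ≤ poissonExpMoment := by
  calc (1 : ℝ≥0∞) = ∫⁻ _, 1 ∂(poissonMeasure 1) := by simp
    _ ≤ _ := lintegral_mono fun n => by
      rw [← ENNReal.ofReal_one]
      exact ENNReal.ofReal_le_ofReal (Real.one_le_exp n.cast_nonneg)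

theorem poissonExpMoment_lt_top : poissonExpMoment < ∞ := by
  have h : Integrable (fun n : ℕ => Real.exp n) (poissonMeasure 1) := by
    rw [integrable_poissonMeasure_iff]
    convert! (NormedSpace.expSeries_div_summable (Real.exp 1)).mul_left (Real.exp (-1)) using 2
    simp [← Real.exp_nat_mul]
    ring
  exact (hasFiniteIntegral_iff_ofReal (ae_of_all _ fun n => (Real.exp_pos _).le)).1 h.2

variable {Ω : Type*} [MeasurableSpace Ω] {P : Measure Ω} {η : Ω → Set Plane}

theorem IsPoissonProcess.measurable_count_unitSquare (h : IsPoissonProcess P η) (z : ℤ × ℤ) :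
    Measurable fun w => (η w ∩ unitSquare z).ncard :=
  h.measurable_count _ (measurableSet_unitSquare z) (isBounded_unitSquare z)

theorem IsPoissonProcess.lintegral_prod_exp (h : IsPoissonProcess P η) (A : Finset (ℤ × ℤ)) :
    ∫⁻ w, ∏ z ∈ A, ENNReal.ofReal (Real.exp (η w ∩ unitSquare z).ncard) ∂P =
      poissonExpMoment ^ A.card := by
  have hexp : Measurable fun n : ℕ => ENNReal.ofReal (Real.exp n) := .of_discrete
  have hone : ∀ z, ∫⁻ w, ENNReal.ofReal (Real.exp (η w ∩ unitSquare z).ncard) ∂P =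
      poissonExpMoment := by
    intro z
    have := h.map_count _ (measurableSet_unitSquare z) (isBounded_unitSquare z)
    rw [volume_unitSquare, ENNReal.toNNReal_one] at this
    rw [poissonExpMoment, ← this, lintegral_map hexp (h.measurable_count_unitSquare z)]
  have hind := (h.indep_count A.card (fun i => unitSquare (A.equivFin.symm i))
    (fun _ => measurableSet_unitSquare _) (fun _ => isBounded_unitSquare _)
    (fun i j hij => pairwise_disjoint_unitSquare fun hc =>
      hij (A.equivFin.symm.injective (Subtype.ext hc)))).comp
      (fun _ n => ENNReal.ofReal (Real.exp n)) (fun _ => hexp)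
  have hprod := lintegral_prod_eq_prod_lintegral_of_indepFun Finset.univ _ hind
    (fun i => hexp.comp (h.measurable_count_unitSquare _))
  simp only [Function.comp_apply, hone, Finset.prod_const, Finset.card_univ,
    Fintype.card_fin] at hprod
  rw [← hprod]
  refine lintegral_congr fun w => ?_
  rw [← Finset.prod_coe_sort]
  exact (Equiv.prod_comp A.equivFin.symm
    fun z : A => ENNReal.ofReal (Real.exp (η w ∩ unitSquare z).ncard)).symm

/-- The sum over all lattice walks from the origin, with `n` steps say, of
`exp (N - K n)`, where `N` is the number of points in the unit squares visited. -/
noncomputable def walkPartition (K : ℝ) (ω : Set Plane) : ℝ≥0∞ :=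
  ∑' n : ℕ, ∑ v : Fin n → Fin 4, ENNReal.ofReal (Real.exp (-K)) ^ n *
    ∏ z ∈ visited (0, 0) (List.ofFn v), ENNReal.ofReal (Real.exp (ω ∩ unitSquare z).ncard)

theorem IsPoissonProcess.measurable_walkPartition (h : IsPoissonProcess P η) (K : ℝ) :
    Measurable fun w => walkPartition K (η w) := by
  refine Measurable.tsum fun n => Finset.measurable_sum _ fun v _ => Measurable.const_mul
    (Finset.measurable_prod _ fun z _ => ?_) _
  exact (Measurable.of_discrete (f := fun n : ℕ => ENNReal.ofReal (Real.exp n))).comp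
    (h.measurable_count_unitSquare z)

/-- Counting `4 ^ n` walks of `n` steps: once `K` is large, the number of walks is beaten by
`exp (-K n)`, and the sum over all walks has a finite expectation. -/
theorem exists_lintegral_walkPartition_le : ∃ K : ℝ, 0 ≤ K ∧ ∃ m : ℝ, 0 ≤ m ∧
    ∀ {Ω : Type*} [MeasurableSpace Ω] (P : Measure Ω) (η : Ω → Set Plane),
      IsPoissonProcess P η → ∫⁻ w, walkPartition K (η w) ∂P ≤ ENNReal.ofReal m := by
  set q := poissonExpMoment.toReal with hq
  have hMq : poissonExpMoment = ENNReal.ofReal q := (ENNReal.ofReal_toReal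
    poissonExpMoment_lt_top.ne).symm
  have hq1 : 1 ≤ q := by
    have := one_le_poissonExpMoment
    rwa [hMq, ENNReal.one_le_ofReal] at this
  have hpos : 0 < 8 * q := by linarith
  -- With this `K` the sum over the walks is geometric of ratio one half.
  refine ⟨Real.log (8 * q), Real.log_nonneg (by linarith), q * 2, by linarith, ?_⟩
  intro Ω _ P η h
  have hexp : Real.exp (-Real.log (8 * q)) = (8 * q)⁻¹ := by rw [Real.exp_neg, Real.exp_log hpos]
  have hmeas : ∀ n (v : Fin n → Fin 4), Measurable fun w =>
      ∏ z ∈ visited (0, 0) (List.ofFn v),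
        ENNReal.ofReal (Real.exp (η w ∩ unitSquare z).ncard) := fun n v =>
    Finset.measurable_prod _ fun z _ =>
      (Measurable.of_discrete (f := fun n : ℕ => ENNReal.ofReal (Real.exp n))).comp
        (h.measurable_count_unitSquare z)
  unfold walkPartition
  rw [lintegral_tsum fun n => (Finset.measurable_sum _ fun v _ =>
    (hmeas n v).const_mul _).aemeasurable]
  have hterm : ∀ n : ℕ, ∫⁻ w, ∑ v : Fin n → Fin 4,
      ENNReal.ofReal (Real.exp (-Real.log (8 * q))) ^ n *
      ∏ z ∈ visited (0, 0) (List.ofFn v),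
        ENNReal.ofReal (Real.exp (η w ∩ unitSquare z).ncard) ∂P ≤
      ENNReal.ofReal q * (2⁻¹ : ℝ≥0∞) ^ n := by
    intro n
    rw [lintegral_finsetSum _ fun v _ => (hmeas n v).const_mul _]
    simp_rw [lintegral_const_mul _ (hmeas n _), h.lintegral_prod_exp, hMq, hexp]
    calc _ ≤ ∑ v : Fin n → Fin 4, ENNReal.ofReal (8 * q)⁻¹ ^ n * ENNReal.ofReal q ^ (n + 1) := by
          gcongr with v
          · simpa using hq1
          · simpa using card_visited_le (0, 0) (List.ofFn v)
      _ = ENNReal.ofReal q * (2⁻¹ : ℝ≥0∞) ^ n := by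
          have h2 : (2⁻¹ : ℝ≥0∞) = ENNReal.ofReal 2⁻¹ := by
            rw [ENNReal.ofReal_inv_of_pos two_pos]; simp
          have hq0 : 0 ≤ q := by linarith
          rw [Finset.sum_const, Finset.card_univ, Fintype.card_fun, Fintype.card_fin,
            Fintype.card_fin, nsmul_eq_mul, h2, ← ENNReal.ofReal_pow (by positivity),
            ← ENNReal.ofReal_pow (by positivity), ← ENNReal.ofReal_pow (by positivity),
            ← ENNReal.ofReal_mul (by positivity), ← ENNReal.ofReal_mul (by positivity),
            ← ENNReal.ofReal_natCast, ← ENNReal.ofReal_mul (by positivity)]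
          congr 1
          rw [pow_succ, mul_inv, mul_pow]
          have : (2⁻¹ : ℝ) = 4 * 8⁻¹ * (q⁻¹ * q) := by field_simp; norm_num
          rw [this]
          simp only [mul_pow]
          push_cast
          ring
  calc _ ≤ ∑' n : ℕ, ENNReal.ofReal q * (2⁻¹ : ℝ≥0∞) ^ n := ENNReal.tsum_le_tsum hterm
    _ = ENNReal.ofReal (q * 2) := by
      rw [ENNReal.tsum_mul_left, ENNReal.tsum_geometric, ENNReal.one_sub_inv_two, inv_inv,
        ENNReal.ofReal_mul (by linarith)]
      simp

/-- A simultaneous linear bound on the weights of all lattice animals. -/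
theorem IsLatticeAnimal.sum_ncard_le {K : ℝ} (hK : 0 ≤ K) {ω : Set Plane}
    (hZ : walkPartition K ω ≠ ∞) {A : Finset (ℤ × ℤ)} (hA : IsLatticeAnimal A) :
    ((∑ z ∈ A, (ω ∩ unitSquare z).ncard : ℕ) : ℝ) ≤
      2 * K * A.card + Real.log (1 + (walkPartition K ω).toReal) := by
  obtain ⟨l, hl, rfl⟩ := hA.exists_visited_eq
  set A := visited (0, 0) l
  set N := ∑ z ∈ A, (ω ∩ unitSquare z).ncard with hN
  have h1 : ENNReal.ofReal (Real.exp (N - K * l.length)) ≤ walkPartition K ω := by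
    refine le_trans (le_trans (le_of_eq ?_) (Finset.single_le_sum (fun _ _ => zero_le)
      (Finset.mem_univ (l.get)))) (ENNReal.le_tsum l.length)
    rw [List.ofFn_get, ← ENNReal.ofReal_prod_of_nonneg (fun _ _ => (Real.exp_pos _).le),
      ← ENNReal.ofReal_pow (Real.exp_pos _).le, ← ENNReal.ofReal_mul (by positivity),
      ← Real.exp_sum, ← Real.exp_nat_mul, ← Real.exp_add]
    congr 2
    rw [hN]
    push_cast
    ring
  have h2 : Real.exp (N - K * l.length) ≤ (walkPartition K ω).toReal :=
    (ENNReal.ofReal_le_iff_le_toReal hZ).1 h1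
  have h3 : (N : ℝ) - K * l.length ≤ Real.log (1 + (walkPartition K ω).toReal) := by
    rw [Real.le_log_iff_exp_le (by positivity)]
    linarith
  have h4 : (l.length : ℝ) ≤ 2 * A.card := by exact_mod_cast hl
  nlinarith [mul_le_mul_of_nonneg_left h4 hK]

/-! ### Deterministic bounds -/

/-- For every lattice animal `A`, the squares of `A` hold at most `κ |A| + X` points of `ω`. -/
def AnimalBound (ω : Set Plane) (κ X : ℝ) : Prop :=
  ∀ A : Finset (ℤ × ℤ), IsLatticeAnimal A →
    ((∑ z ∈ A, (ω ∩ unitSquare z).ncard : ℕ) : ℝ) ≤ κ * A.card + X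

theorem action_le {ω S : Set Plane} {s : ℝ} (hs : 0 < s) {y : Plane} (hy : y ∈ S) (hy0 : y ≠ 0) :
    action ω s 0 S ≤ ((‖y‖ ^ 2 / (2 * s) : ℝ) : EReal) := by
  set γ : ℝ → Plane := fun u => u • (s⁻¹ • y) with hγ
  have hv : s⁻¹ • y ≠ 0 := smul_ne_zero (inv_ne_zero hs.ne') hy0
  have hmem : γ ∈ pathsTo ω s 0 S := by
    refine ⟨⟨⟨1, fun i => i * s, by simp, by simp, fun i _ => by
      push_cast; linarith, fun i _ =>
      ⟨0, s⁻¹ • y, fun u _ => by simp [hγ]⟩⟩, ?_⟩, by simp [hγ], by simpa [hγ, smul_smul, hs.ne']⟩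
    rintro p - u ⟨-, hu⟩ u' ⟨-, hu'⟩
    exact smul_left_injective ℝ hv (hu.trans hu'.symm)
  have hderiv : ∀ u, deriv γ u = s⁻¹ • y := fun u => by
    simpa using ((hasDerivAt_id u).smul_const (s⁻¹ • y)).deriv
  refine (iInf₂_le γ hmem).trans (EReal.coe_le_coe_iff.2 ?_)
  have : (1 / 2) * ∫ u in (0 : ℝ)..s, ‖deriv γ u‖ ^ 2 = ‖y‖ ^ 2 / (2 * s) := by
    simp_rw [hderiv, intervalIntegral.integral_const, norm_smul, norm_inv, Real.norm_eq_abs,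
      abs_of_pos hs, smul_eq_mul]
    field_simp
    ring
  rw [pathAction, this]
  linarith [Nat.cast_nonneg (α := ℝ) (touchedPoints ω s γ).ncard]

theorem AnimalBound.le_pathAction {ω S : Set Plane} {κ X s : ℝ} (h : AnimalBound ω κ X)
    (hω : ∀ B, Bornology.IsBounded B → (ω ∩ B).Finite) (hκ : 0 ≤ κ) (hs : 0 < s) {γ : ℝ → Plane}
    (hγ : γ ∈ pathsTo ω s 0 S) :
    pathLength s γ ^ 2 / (2 * s) - 9 * κ * (pathLength s γ + 1) - X ≤ pathAction ω s γ := by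
  obtain ⟨⟨hpl, -⟩, h0, -⟩ := hγ
  obtain ⟨A, hA, hcard, hsub⟩ := hpl.exists_animal h0
  have h1 : ((touchedPoints ω s γ).ncard : ℝ) ≤ κ * A.card + X :=
    le_trans (by exact_mod_cast ncard_touchedPoints_le hω hsub) (h A hA)
  have h2 := hpl.sq_pathLength_le hs
  have h3 : pathLength s γ ^ 2 / (2 * s) = (1 / 2) * (pathLength s γ ^ 2 / s) := by
    field_simp
  have h4 := mul_le_mul_of_nonneg_left hcard hκ
  rw [pathAction, h3]
  linarith

theorem IsMinimizer.pathAction_le {ω S : Set Plane} {s : ℝ} {γ : ℝ → Plane}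
    (h : IsMinimizer ω s 0 S γ) (hs : 0 < s) {y : Plane} (hy : y ∈ S) (hy0 : y ≠ 0) :
    pathAction ω s γ ≤ ‖y‖ ^ 2 / (2 * s) := by
  have := action_le (ω := ω) hs hy hy0
  rw [← h.2] at this
  exact EReal.coe_le_coe_iff.1 this

/-- The lower bound comes from completing the square in the length of a path. -/
theorem AnimalBound.abs_action_le {ω S : Set Plane} {κ X c t : ℝ} (h : AnimalBound ω κ X)
    (hω : ∀ B, Bornology.IsBounded B → (ω ∩ B).Finite) (hκ : 0 ≤ κ) (hX : 0 ≤ X)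
    (hc : 0 < c) (hc1 : c ≤ 1) (ht : 1 ≤ t) {y : Plane} (hy : y ∈ S) (hyt : ‖y‖ = t) :
    (action ω (c * t) 0 S).abs ≤
      ENNReal.ofReal ((81 * κ ^ 2 + 9 * κ + 1) * (t / c) * (1 + X)) := by
  have hs : 0 < c * t := by positivity
  have hy0 : y ≠ 0 := by rw [← norm_ne_zero_iff, hyt]; positivity
  set b := (81 * κ ^ 2 + 9 * κ + 1) * (t / c) * (1 + X) with hb
  have htc : t ≤ t / c := le_div_self (by linarith) hc hc1
  have hst : c * t ≤ t := mul_le_of_le_one_left (by linarith) hc1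
  have hbase : (81 * κ ^ 2 + 9 * κ + 1) * (t / c) + t / c * X ≤ b := by
    have : 0 ≤ (81 * κ ^ 2 + 9 * κ) * (t / c * X) := by positivity
    rw [hb]; nlinarith
  have htX : X ≤ t / c * X := le_mul_of_one_le_left hX (ht.trans htc)
  have hup : action ω (c * t) 0 S ≤ (b : EReal) := by
    refine (action_le hs hy hy0).trans (EReal.coe_le_coe_iff.2 ?_)
    have : ‖y‖ ^ 2 / (2 * (c * t)) = (1 / 2) * (t / c) := by rw [hyt]; field_simp
    rw [this]
    have : 0 ≤ (81 * κ ^ 2 + 9 * κ) * (t / c) := by positivity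
    have : 0 ≤ t / c := by positivity
    nlinarith
  have hlow : ((-b : ℝ) : EReal) ≤ action ω (c * t) 0 S := by
    refine le_iInf₂ fun γ hγ => EReal.coe_le_coe_iff.2 ?_
    refine le_trans ?_ (h.le_pathAction hω hκ hs hγ)
    set L := pathLength (c * t) γ
    have hsq : 0 ≤ (L - 9 * κ * (c * t)) ^ 2 / (2 * (c * t)) := by positivity
    have hexp : (L - 9 * κ * (c * t)) ^ 2 / (2 * (c * t)) =
        L ^ 2 / (2 * (c * t)) - 9 * κ * L + 81 * κ ^ 2 * (c * t) / 2 := by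
      field_simp; ring
    have h1 : κ ^ 2 * (c * t) ≤ κ ^ 2 * (t / c) :=
      mul_le_mul_of_nonneg_left (hst.trans htc) (sq_nonneg κ)
    have h2 : κ * 1 ≤ κ * (t / c) := mul_le_mul_of_nonneg_left (ht.trans htc) hκ
    have h3 : 0 ≤ κ ^ 2 * (t / c) := by positivity
    nlinarith
  obtain ⟨a, ha⟩ : ∃ a : ℝ, action ω (c * t) 0 S = (a : EReal) := by
    induction hx : action ω (c * t) 0 S with
    | bot => rw [hx] at hlow; exact absurd hlow (by simp)
    | top => rw [hx] at hup; exact absurd hup (by simp)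
    | coe a => exact ⟨a, rfl⟩
  rw [ha] at hup hlow ⊢
  rw [EReal.abs_def]
  exact ENNReal.ofReal_le_ofReal
    (abs_le.2 ⟨EReal.coe_le_coe_iff.1 hlow, EReal.coe_le_coe_iff.1 hup⟩)

/-- A minimizer has no more action than the straight line, whence a quadratic inequality for its
length. -/
theorem AnimalBound.sq_pathLength_le {ω S : Set Plane} {κ X c t : ℝ} (h : AnimalBound ω κ X)
    (hω : ∀ B, Bornology.IsBounded B → (ω ∩ B).Finite) (hκ : 0 ≤ κ) (hX : 0 ≤ X)
    (hc : 0 < c) (hc1 : c ≤ 1) (ht : 1 ≤ t) {y : Plane} (hy : y ∈ S) (hyt : ‖y‖ = t)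
    {γ : ℝ → Plane} (hγ : IsMinimizer ω (c * t) 0 S γ) :
    pathLength (c * t) γ ^ 2 ≤ (18 * κ + 2) ^ 2 * t ^ 2 * (1 + X) := by
  have hs : 0 < c * t := by positivity
  have hy0 : y ≠ 0 := by rw [← norm_ne_zero_iff, hyt]; positivity
  have h1 := (h.le_pathAction hω hκ hs hγ.1).trans (hγ.pathAction_le hs hy hy0)
  set L := pathLength (c * t) γ
  have hst : c * t ≤ t := mul_le_of_le_one_left (by linarith) hc1
  have hL : 0 ≤ L := pathLength_nonneg hs.le γ
  rw [hyt] at h1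
  have h2 : L ^ 2 ≤ t ^ 2 + 2 * (c * t) * (9 * κ * (L + 1) + X) := by
    have e1 : L ^ 2 = 2 * (c * t) * (L ^ 2 / (2 * (c * t))) := by field_simp
    have e2 : t ^ 2 = 2 * (c * t) * (t ^ 2 / (2 * (c * t))) := by field_simp
    nlinarith
  have h3 : 2 * (c * t) * (9 * κ * (L + 1) + X) ≤ 2 * t * (9 * κ * (L + 1) + X) := by
    gcongr
  have h4 : 0 ≤ (L - 18 * κ * t) ^ 2 := sq_nonneg _
  have h5 : t ≤ t ^ 2 := by nlinarith
  have h6 : κ * t ≤ κ * t ^ 2 := mul_le_mul_of_nonneg_left h5 hκ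
  have h7 : t * X ≤ t ^ 2 * X := mul_le_mul_of_nonneg_right h5 hX
  have h8 : 0 ≤ κ * t ^ 2 * X := by positivity
  have h9 : 0 ≤ κ ^ 2 * t ^ 2 * X := by positivity
  have h10 : 0 ≤ κ * t ^ 2 := by positivity
  nlinarith

theorem AnimalBound.sq_ncard_passedSquares_le {ω S : Set Plane} {κ X c t : ℝ}
    (h : AnimalBound ω κ X)
    (hω : ∀ B, Bornology.IsBounded B → (ω ∩ B).Finite) (hκ : 0 ≤ κ) (hX : 0 ≤ X)
    (hc : 0 < c) (hc1 : c ≤ 1) (ht : 1 ≤ t) {y : Plane} (hy : y ∈ S) (hyt : ‖y‖ = t)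
    {γ : ℝ → Plane} (hγ : IsMinimizer ω (c * t) 0 S γ) :
    ((passedSquares (c * t) γ).ncard : ℝ) ^ 2 ≤ (18 * (18 * κ + 3)) ^ 2 * t ^ 2 * (1 + X) := by
  obtain ⟨A, hA, hcard, hsub⟩ := hγ.1.1.1.exists_animal hγ.1.2.1
  have h1 : ((passedSquares (c * t) γ).ncard : ℝ) ≤ A.card := by
    have := ncard_le_ncard hsub
    rw [ncard_coe_finset] at this
    exact_mod_cast this
  have h2 := h.sq_pathLength_le hω hκ hX hc hc1 ht hy hyt hγ
  set L := pathLength (c * t) γ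
  have h3 : ((passedSquares (c * t) γ).ncard : ℝ) ^ 2 ≤ (9 * (L + 1)) ^ 2 :=
    pow_le_pow_left₀ (Nat.cast_nonneg _) (h1.trans hcard) 2
  have h4 : 0 ≤ (L - 1) ^ 2 := sq_nonneg _
  have h5 : 1 ≤ t ^ 2 * (1 + X) := one_le_mul_of_one_le_of_one_le (one_le_pow₀ ht) (by linarith)
  have h6 : 0 ≤ κ * (t ^ 2 * (1 + X)) := by positivity
  nlinarith

theorem AnimalBound.greedyWeight_le {ω : Set Plane} {κ X : ℝ} (h : AnimalBound ω κ X) (n : ℕ) :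
    greedyWeight ω n ≤ ENNReal.ofReal (κ * n + X) := by
  refine iSup_le fun A => iSup_le fun hA => iSup_le fun hn => ?_
  subst hn
  rw [← Nat.cast_sum, ← ENNReal.ofReal_natCast]
  exact ENNReal.ofReal_le_ofReal (h A hA)

/-! ### Moment bounds -/

/-- `(D T (1 + X)) ^ k` is bounded by the exponential of `X = log (1 + Z)`. -/
theorem pow_mul_one_add_log_le {D T Z : ℝ} (hD : 0 ≤ D) (hT : 0 ≤ T) (hZ : 0 ≤ Z) (k : ℕ) :
    (D * T * (1 + Real.log (1 + Z))) ^ k ≤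
      D ^ k * T ^ k * (k.factorial * Real.exp 1) * (1 + Z) := by
  have hX : 0 ≤ 1 + Real.log (1 + Z) := by
    have := Real.log_nonneg (x := 1 + Z) (by linarith)
    linarith
  have h1 := Real.pow_div_factorial_le_exp _ hX k
  rw [Real.exp_add, Real.exp_log (by linarith), div_le_iff₀ (by positivity)] at h1
  calc _ = D ^ k * T ^ k * (1 + Real.log (1 + Z)) ^ k := by rw [mul_pow, mul_pow]
    _ ≤ D ^ k * T ^ k * (Real.exp 1 * (1 + Z) * k.factorial) := by gcongr
    _ = _ := by ring

/-- If `Z` is integrable, then the `k`-th moment of a random variable of size `T (1 + log (1 + Z))`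
is of order `T ^ k`. The variable `f` itself need not be measurable: its majorant, an affine
function of `Z`, is. -/
theorem upperExp_le_of_le_log {Ω : Type*} [MeasurableSpace Ω] {P : Measure Ω}
    [IsProbabilityMeasure P] {Z : Ω → ℝ≥0∞} (hZ : Measurable Z) {m : ℝ} (hm : 0 ≤ m)
    (hZm : ∫⁻ w, Z w ∂P ≤ ENNReal.ofReal m) {f : Ω → ℝ≥0∞} {D T : ℝ} (hD : 0 ≤ D) (hT : 0 ≤ T)
    {k : ℕ} (hf : ∀ᵐ w ∂P, Z w ≠ ∞ → f w ≤
      ENNReal.ofReal ((D * T * (1 + Real.log (1 + (Z w).toReal))) ^ k)) :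
    upperExp P f ≤ ENNReal.ofReal (D ^ k * (k.factorial * Real.exp 1 * (1 + m)) * T ^ k) := by
  set a := D ^ k * T ^ k * (k.factorial * Real.exp 1) with ha
  have ha0 : 0 ≤ a := by positivity
  have hfin : ∀ᵐ w ∂P, Z w < ∞ := ae_lt_top hZ (hZm.trans_lt ENNReal.ofReal_lt_top).ne
  refine iInf_le_of_le (fun w => ENNReal.ofReal a * (1 + Z w)) (iInf_le_of_le (by fun_prop)
    (iInf_le_of_le ?_ ?_))
  · filter_upwards [hf, hfin] with w hw hlt
    refine (hw hlt.ne).trans ((ENNReal.ofReal_le_ofReal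
      (pow_mul_one_add_log_le hD hT ENNReal.toReal_nonneg k)).trans (le_of_eq ?_))
    rw [ENNReal.ofReal_mul ha0, ENNReal.ofReal_add zero_le_one ENNReal.toReal_nonneg,
      ENNReal.ofReal_toReal hlt.ne, ENNReal.ofReal_one]
  · rw [lintegral_const_mul _ (by fun_prop), lintegral_add_left measurable_const]
    calc _ ≤ ENNReal.ofReal a * (1 + ENNReal.ofReal m) := by gcongr; simp
      _ = _ := by
        rw [← ENNReal.ofReal_one, ← ENNReal.ofReal_add zero_le_one hm, ← ENNReal.ofReal_mul ha0]
        congr 1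
        rw [ha]; ring

end FPP

open FPP in
theorem lemma3p3 :
    ∃ C : ℕ → ℝ, ∀ k : ℕ, ∃ t₀ : ℝ, ∀ c : ℝ, 0 < c → c ≤ 1 → ∀ t : ℝ, t₀ ≤ t →
      ∀ S : Set FPP.Plane, (∃ y ∈ S, ‖y‖ = t) →
      ∀ {Ω : Type*} [MeasurableSpace Ω] (P : Measure Ω) [IsProbabilityMeasure P]
        (η : Ω → Set FPP.Plane), FPP.IsPoissonProcess P η →
        FPP.upperExp P (fun w => (FPP.action (η w) (c * t) 0 S).abs ^ k)
            ≤ ENNReal.ofReal (C k * c ^ (-(k : ℝ)) * t ^ k) ∧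
        ∀ M : Ω → ℝ → FPP.Plane,
          (∀ᵐ w ∂P, FPP.IsMinimizer (η w) (c * t) 0 S (M w)) →
          FPP.upperExp P (fun w => FPP.greedyWeight (η w)
                (FPP.touchedSquares (η w) (c * t) (M w)).ncard ^ k)
              ≤ ENNReal.ofReal (C k * c ^ (-(k : ℝ) / 2) * t ^ k) ∧
          FPP.upperExp P (fun w => FPP.greedyWeight (η w)
                (FPP.passedSquares (c * t) (M w)).ncard ^ k)
              ≤ ENNReal.ofReal (C k * c ^ (-(k : ℝ) / 2) * t ^ k) ∧
          FPP.upperExp P (fun w => ENNReal.ofReal (FPP.pathLength (c * t) (M w)) ^ (2 * k))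
              ≤ ENNReal.ofReal (C (2 * k) * t ^ (2 * k)) ∧
          FPP.upperExp P (fun w =>
                ((FPP.touchedSquares (η w) (c * t) (M w)).ncard : ℝ≥0∞) ^ (2 * k))
              ≤ ENNReal.ofReal (C (2 * k) * t ^ (2 * k)) ∧
          FPP.upperExp P (fun w =>
                ((FPP.passedSquares (c * t) (M w)).ncard : ℝ≥0∞) ^ (2 * k))
              ≤ ENNReal.ofReal (C (2 * k) * t ^ (2 * k)) := by
  obtain ⟨K, hK, m, hm, hmom⟩ := exists_lintegral_walkPartition_le
  set κ := 2 * K with hκdef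
  have hκ : 0 ≤ κ := by positivity
  -- `a` bounds the number of squares, `D` everything else.
  set a := 18 * (18 * κ + 3) with hadef
  have ha : 54 ≤ a := by rw [hadef]; linarith
  set D := a ^ 2 * (κ + 1) with hDdef
  have hDa : a ^ 2 ≤ D := by rw [hDdef]; nlinarith [sq_nonneg a]
  have hD0 : 0 ≤ D := (sq_nonneg a).trans hDa
  have hD1 : 1 ≤ D := by nlinarith
  have hDκ : κ * a + 1 ≤ D := by rw [hDdef]; nlinarith [mul_nonneg hκ (by linarith : 0 ≤ a)]
  have hDq : 81 * κ ^ 2 + 9 * κ + 1 ≤ D := by nlinarith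
  have hDL : (18 * κ + 2) ^ 2 ≤ D := by nlinarith
  set C : ℕ → ℝ := fun k => D ^ k * (k.factorial * Real.exp 1 * (1 + m)) with hC
  have hC0 : ∀ k, 0 ≤ C k := fun k => by positivity
  have hCmono : ∀ k, C k ≤ C (2 * k) := by
    intro k
    simp only [hC]
    gcongr <;> first | exact hD1 | omega
  refine ⟨C, fun k => ⟨1, ?_⟩⟩
  intro c hc hc1 t ht S ⟨y, hy, hyt⟩ Ω _ P _ η hη
  set Z : Ω → ℝ≥0∞ := fun w => walkPartition K (η w)
  have hZ : Measurable Z := hη.measurable_walkPartition K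
  have hZm : ∫⁻ w, Z w ∂P ≤ ENNReal.ofReal m := hmom P η hη
  have hX : ∀ w, 0 ≤ Real.log (1 + (Z w).toReal) := fun w =>
    Real.log_nonneg (by linarith [ENNReal.toReal_nonneg (a := Z w)])
  have hb : ∀ w, Z w ≠ ∞ → AnimalBound (η w) κ (Real.log (1 + (Z w).toReal)) :=
    fun w hw A hA => hA.sum_ncard_le hK hw
  have hfin := hη.locallyFinite
  have ht0 : 0 ≤ t := by linarith
  refine ⟨?_, fun M hM => ?_⟩
  · have := upperExp_le_of_le_log hZ hm hZm (D := D) (T := t / c) (k := k)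
      (f := fun w => (action (η w) (c * t) 0 S).abs ^ k) hD0 (by positivity) (ae_of_all _ ?_)
    · refine this.trans (ENNReal.ofReal_le_ofReal (le_of_eq ?_))
      rw [Real.rpow_neg hc.le, Real.rpow_natCast, div_pow]
      ring
    · intro w hw
      have h1 := (hb w hw).abs_action_le (hfin w) hκ (hX w) hc hc1 ht hy hyt
      have := hX w
      rw [ENNReal.ofReal_pow (by positivity)]
      gcongr
      refine h1.trans (ENNReal.ofReal_le_ofReal ?_)
      gcongr
  -- The number of squares enters linearly, and `√(1 + X) ≤ 1 + X`.
  have hgreedy : ∀ n : Ω → ℕ, (∀ᵐ w ∂P, n w ≤ (passedSquares (c * t) (M w)).ncard) →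
      upperExp P (fun w => greedyWeight (η w) (n w) ^ k) ≤
        ENNReal.ofReal (C k * c ^ (-(k : ℝ) / 2) * t ^ k) := by
    intro n hn
    have := upperExp_le_of_le_log hZ hm hZm (D := D) (T := t) (k := k)
      (f := fun w => greedyWeight (η w) (n w) ^ k) hD0 ht0 ?_
    · refine this.trans (ENNReal.ofReal_le_ofReal ?_)
      have : 1 ≤ c ^ (-(k : ℝ) / 2) := Real.one_le_rpow_of_pos_of_le_one_of_nonpos hc hc1
        (by have := Nat.cast_nonneg (α := ℝ) k; linarith)
      exact mul_le_mul_of_nonneg_right (le_mul_of_one_le_right (hC0 k) this) (by positivity)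
    · filter_upwards [hM, hn] with w hMw hnw hw
      have hXw := hX w
      have h1 := (hb w hw).sq_ncard_passedSquares_le (hfin w) hκ hXw hc hc1 ht hy hyt hMw
      set X := Real.log (1 + (Z w).toReal)
      rw [ENNReal.ofReal_pow (by positivity)]
      gcongr
      refine ((hb w hw).greedyWeight_le (n w)).trans (ENNReal.ofReal_le_ofReal ?_)
      have h2 : (n w : ℝ) ≤ a * t * (1 + X) := by
        refine le_trans (Nat.cast_le.2 hnw) (abs_le_of_sq_le_sq' ?_ (by positivity)).2
        have hX2 : 1 + X ≤ (1 + X) ^ 2 := by nlinarith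
        rw [mul_pow, mul_pow]
        exact h1.trans (mul_le_mul_of_nonneg_left hX2 (by positivity))
      have h3 : X ≤ t * (1 + X) := by nlinarith
      calc κ * n w + X ≤ κ * (a * t * (1 + X)) + t * (1 + X) := by gcongr
        _ = (κ * a + 1) * t * (1 + X) := by ring
        _ ≤ D * t * (1 + X) := by gcongr
  -- A bound on the square of a variable controls its `2 k`-th power by a `k`-th power.
  have hsq : ∀ f : Ω → ℝ, (∀ w, 0 ≤ f w) →
      (∀ᵐ w ∂P, Z w ≠ ∞ → f w ^ 2 ≤ D * t ^ 2 * (1 + Real.log (1 + (Z w).toReal))) →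
      upperExp P (fun w => ENNReal.ofReal (f w) ^ (2 * k)) ≤
        ENNReal.ofReal (C (2 * k) * t ^ (2 * k)) := by
    intro f hf0 hf
    have := upperExp_le_of_le_log hZ hm hZm (D := D) (T := t ^ 2) (k := k)
      (f := fun w => ENNReal.ofReal (f w) ^ (2 * k)) hD0 (by positivity) ?_
    · refine this.trans (ENNReal.ofReal_le_ofReal ?_)
      rw [pow_mul t]
      exact mul_le_mul_of_nonneg_right (hCmono k) (by positivity)
    · filter_upwards [hf] with w hfw hw
      rw [pow_mul, ← ENNReal.ofReal_pow (hf0 w), ← ENNReal.ofReal_pow (sq_nonneg _)]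
      exact ENNReal.ofReal_le_ofReal (pow_le_pow_left₀ (sq_nonneg _) (hfw hw) k)
  have hpassed : ∀ᵐ w ∂P, Z w ≠ ∞ → ((passedSquares (c * t) (M w)).ncard : ℝ) ^ 2 ≤
      D * t ^ 2 * (1 + Real.log (1 + (Z w).toReal)) := by
    filter_upwards [hM] with w hMw hw
    have hXw := hX w
    refine ((hb w hw).sq_ncard_passedSquares_le (hfin w) hκ hXw hc hc1 ht hy hyt hMw).trans ?_
    gcongr
  have hle : ∀ᵐ w ∂P, (touchedSquares (η w) (c * t) (M w)).ncard ≤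
      (passedSquares (c * t) (M w)).ncard := by
    filter_upwards [hM] with w hMw
    exact hMw.1.1.1.ncard_touchedSquares_le _ hMw.1.2.1
  refine ⟨hgreedy _ hle, hgreedy _ (ae_of_all _ fun _ => le_rfl), ?_, ?_, ?_⟩
  · refine hsq _ (fun w => pathLength_nonneg (by positivity) _) ?_
    filter_upwards [hM] with w hMw hw
    have hXw := hX w
    refine ((hb w hw).sq_pathLength_le (hfin w) hκ hXw hc hc1 ht hy hyt hMw).trans ?_
    gcongr
  · simp_rw [← ENNReal.ofReal_natCast]
    refine hsq _ (fun w => Nat.cast_nonneg _) ?_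
    filter_upwards [hpassed, hle] with w hw hlew hwZ
    exact (pow_le_pow_left₀ (Nat.cast_nonneg _) (Nat.cast_le.2 hlew) 2).trans (hw hwZ)
  · simp_rw [← ENNReal.ofReal_natCast]
    exact hsq _ (fun w => Nat.cast_nonneg _) hpassed
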